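/- Let $m,n\ge 0$ be integers. A unary $m$-lighted $n$-shade is a finite sequence, read from top to bottom, of items of two kinds: singletons $(s)$ with $s\ge 1$ an integer, and cuts, each carrying one label from $[m]=\{1,\dots,m\}$, such that the values of the singletons sum to $n$ and each label of $[m]$ occurs on exactly one cut. (Equivalently, it is an $m$-lighted $n$-shade of rank $0$. Here an $m$-lighted $n$-shade is a sequence $S$ of possibly empty tuples of positive integers with total sum $n$, with a set of $k$ distinguished positions containing all positions of empty tuples, and an ordered partition of $[m]$ into $k$ nonempty parts labelling these positions from top to bottom; its rank is $m-|S|+\|S\|$, where $|S|$ is the number of tuples and $\|S\|$ is the total number of their entries.) The right rotation digraph on unary $m$-lighted $n$-shades has an edge $\mathbb{S}\to\mathbb{S}'$ if and only if $\mathbb{S}'$ is obtained from $\mathbb{S}$ by one of the following operations: (i) replace a singleton $(r)$ by two consecutive singletons $(s),(t)$ (with $(s)$ above $(t)$), where $r=s+t$ and $s,t\ge 1$; (ii) exchange a singleton with the cut immediately below it; (iii) exchange the labels of two consecutive cuts with no singleton in between them, the larger label being above the smaller one before the exchange, so that the smaller one is above afterwards. **Proposition.** For all $m,n\ge 0$,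 the right rotation digraph on unary $m$-lighted $n$-shades is the Hasse diagram of a lattice: the reflexive and transitive closure of the edge relation is a partial order, this order is a lattice, and its cover relations are exactly the edges of the digraph. Moreover: - For $m=1$ this lattice is the Hochschild lattice with the order reversed: it is anti-isomorphic to the set of triwords of length $n$, i.e. words $w_1\cdots w_n$ in the letters $\{0,1,2\}$ such that $w_1\ne 2$ and such that $w_i=1$ implies $w_j\ge 1$ for all $j<i$, ordered componentwise. - For $m=0$ this lattice is boolean: it is isomorphic to the lattice of all subsets of a set with $\max(n-1,0)$ elements, ordered by inclusion. -/

import Mathlib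

/-- An `m`-lighted `n`-shade, written from top to bottom as a list of levels.  A level is a pair
`(s, c)`: `s` is a (possibly empty) tuple of positive integers, and `c` is the set of labels of
the cut at this position, with `c = ∅` when the position is not distinguished.  The labels
`1, …, m` are the elements of `Fin m`.  The nonempty sets `c`, read from top to bottom, form an
ordered partition of the set of labels. -/
structure LightedShade (m n : ℕ) where
  levels : List (List ℕ × Finset (Fin m))
  entries_pos : ∀ L ∈ levels, ∀ x ∈ L.1, 0 < x
  sum_eq : (levels.map fun L => L.1.sum).sum = n
  label_once : ∀ a : Fin m, levels.countP (fun L => a ∈ L.2) = 1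
  lit_of_empty : ∀ L ∈ levels, L.1 = [] → L.2.Nonempty

namespace LightedShade

variable {m n : ℕ}

/-- The rank `m - |S| + ‖S‖`, where `|S|` is the number of tuples and `‖S‖` the total number of
entries. -/
def rank (s : LightedShade m n) : ℤ :=
  m - s.levels.length + ((s.levels.map fun L => L.1.length).sum : ℕ)

/-- Unary lighted shades: each level is either an empty tuple carrying a cut with a single label,
or a singleton tuple carrying no cut.  These are the lighted shades of rank `0`, see
`isUnary_iff_rank_eq_zero`. -/
def IsUnary (s : LightedShade m n) : Prop :=
  ∀ L ∈ s.levels, (∃ a : Fin m, L = ([], {a})) ∨ (∃ x : ℕ, L = ([x], ∅))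

theorem sum_countP_eq (l : List (List ℕ × Finset (Fin m))) :
    ∑ a : Fin m, l.countP (fun L => a ∈ L.2) = (l.map fun L => L.2.card).sum := by
  induction l with
  | nil => simp
  | cons L l ih =>
    simp only [List.countP_cons, List.map_cons, List.sum_cons, Finset.sum_add_distrib, ih]
    simp [add_comm]

theorem length_eq_iff (l : List (List ℕ × Finset (Fin m)))
    (h : ∀ L ∈ l, L.1 = [] → L.2.Nonempty) :
    l.length ≤ (l.map fun L => L.1.length).sum + (l.map fun L => L.2.card).sum ∧
      ((l.map fun L => L.1.length).sum + (l.map fun L => L.2.card).sum = l.length ↔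
        ∀ L ∈ l, (∃ a : Fin m, L = ([], {a})) ∨ (∃ x : ℕ, L = ([x], ∅))) := by
  induction l with
  | nil => simp
  | cons L l ih =>
    obtain ⟨h1, h2⟩ := ih (fun K hK => h K (List.mem_cons_of_mem _ hK))
    have h3 : 1 ≤ L.1.length + L.2.card := by
      rcases hL : L.1 with _ | ⟨x, t⟩
      · have := (h L List.mem_cons_self hL).card_pos
        omega
      · simp only [List.length_cons]
        omega
    have h4 : L.1.length + L.2.card = 1 ↔
        (∃ a : Fin m, L = ([], {a})) ∨ (∃ x : ℕ, L = ([x], ∅)) := by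
      obtain ⟨t, c⟩ := L
      constructor
      · intro e
        simp only at e
        rcases Nat.add_eq_one_iff.mp e with ⟨e1, e2⟩ | ⟨e1, e2⟩
        · obtain ⟨a, rfl⟩ := Finset.card_eq_one.mp e2
          obtain rfl := List.length_eq_zero_iff.mp e1
          exact Or.inl ⟨a, rfl⟩
        · obtain ⟨x, rfl⟩ := List.length_eq_one_iff.mp e1
          obtain rfl := Finset.card_eq_zero.mp e2
          exact Or.inr ⟨x, rfl⟩
      · rintro (⟨a, e⟩ | ⟨x, e⟩) <;> cases e <;> simp
    simp only [List.map_cons, List.sum_cons, List.length_cons, List.forall_mem_cons, ← h4, ← h2]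
    omega

theorem isUnary_iff_rank_eq_zero (s : LightedShade m n) : s.IsUnary ↔ s.rank = 0 := by
  have h1 := sum_countP_eq s.levels
  simp only [s.label_once, Finset.sum_const, Finset.card_univ, Fintype.card_fin, smul_eq_mul,
    mul_one] at h1
  have h2 := (length_eq_iff s.levels s.lit_of_empty).2
  unfold IsUnary rank
  rw [← h2, ← h1]
  omega

end LightedShade

/-- The unary `m`-lighted `n`-shades. -/
def UnaryLightedShade (m n : ℕ) : Type :=
  {s : LightedShade m n // s.IsUnary}

/-- The right rotations, on lists of levels read from top to bottom. -/
inductive RotationStep {m : ℕ} :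
    List (List ℕ × Finset (Fin m)) → List (List ℕ × Finset (Fin m)) → Prop
  /-- Replace a singleton `(r)` by two singletons `(s)`, `(t)` with `r = s + t`. -/
  | split (A B : List (List ℕ × Finset (Fin m))) (s t : ℕ) (hs : 1 ≤ s) (ht : 1 ≤ t) :
      RotationStep (A ++ ([s + t], ∅) :: B) (A ++ ([s], ∅) :: ([t], ∅) :: B)
  /-- Exchange a singleton with the cut just below it. -/
  | sweep (A B : List (List ℕ × Finset (Fin m))) (s : ℕ) (a : Fin m) :
      RotationStep (A ++ ([s], ∅) :: ([], {a}) :: B) (A ++ ([], {a}) :: ([s], ∅) :: B)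
  /-- Exchange the labels of two consecutive cuts with no singleton in between, passing the small
  label above the large label. -/
  | swap (A B : List (List ℕ × Finset (Fin m))) (a b : Fin m) (hab : a < b) :
      RotationStep (A ++ ([], {b}) :: ([], {a}) :: B) (A ++ ([], {a}) :: ([], {b}) :: B)

/-- The edges of the right rotation digraph on unary `m`-lighted `n`-shades. -/
def RightRotation {m n : ℕ} (s t : UnaryLightedShade m n) : Prop :=
  RotationStep s.1.levels t.1.levels

/-- Triwords of length `n`: words in the letters `0, 1, 2` that do not start with `2` and in which
no `1` is preceded by a `0`.  Ordered componentwise (the order inherited from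
`Fin n → Fin 3`), they form the Hochschild lattice. -/
abbrev Triword (n : ℕ) : Type :=
  {w : Fin n → Fin 3 //
    (∀ i : Fin n, i.val = 0 → w i ≠ 2) ∧ (∀ i j : Fin n, j < i → w i = 1 → w j ≠ 0)}

/-! ### Positions in a list without repetitions -/

/-! The argument follows the weak order on permutations. Number the units of the shade `m + 1, …, m
+ n` after the labels `0, …, m - 1`, and record a shade as the word of its labels and of the last
units of its singletons. Splitting a singleton inserts a letter just before a larger end; the other
two rotations swap adjacent letters `y x` with `x < y` and `x` a label.

A label `x` and a unit `y` form a noninversion when the cut `x` is above the singleton containing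
`y`, whether or not `y` is itself a letter. Hence splitting leaves the noninversions unchanged
(`noninv_insert_iff`), and words with different singletons can be compared. The order is inclusion
of letter sets together with inclusion of noninversion sets. Its covers are the rotations:
`covBy_of_wordStep` shows that each rotation is a cover, and `exists_wordStep_of_lt` starts a path
of rotations below any strict inequality.

Noninversions are transitive and cotransitive; conversely, a relation with both properties sorts a
set of letters into a word (`exists_of_rel`). For a join, take the union of the letters and the
transitive closure of the union of the noninversions, which remains cotransitive. Meets follow from
finiteness and a least word.

For `m = 0` only the set of ends remains. For `m = 1` each unit is marked by whether it starts a
singleton and on which side of the cut it lies, which gives a triword. -/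

namespace List

/-- `x` occurs before `y` in `l` (by first occurrences; elements outside of `l` come last). -/
def Before (l : List ℕ) (x y : ℕ) : Prop :=
  l.idxOf x < l.idxOf y

theorem Before.trans {l : List ℕ} {x y z : ℕ} (h : l.Before x y) (h' : l.Before y z) :
    l.Before x z :=
  Nat.lt_trans h h'

theorem Before.asymm {l : List ℕ} {x y : ℕ} (h : l.Before x y) : ¬ l.Before y x :=
  Nat.lt_asymm h

theorem before_or_before {l : List ℕ} {x y : ℕ} (hx : x ∈ l) (hxy : x ≠ y) :
    l.Before x y ∨ l.Before y x :=
  Nat.lt_or_gt_of_ne fun h => hxy ((idxOf_inj hx).1 h)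

theorem Nodup.pairwise_before {l : List ℕ} (h : l.Nodup) : l.Pairwise l.Before := by
  rw [pairwise_iff_getElem]
  intro i j hi hj hij
  simpa only [Before, h.idxOf_getElem] using hij

theorem Pairwise.rel_of_before {R : ℕ → ℕ → Prop} {l : List ℕ} (h : l.Pairwise R) {x y : ℕ}
    (hy : y ∈ l) (hxy : l.Before x y) : R x y := by
  have hj := idxOf_lt_length_iff.2 hy
  have hi : l.idxOf x < l.length := Nat.lt_trans hxy hj
  simpa only [getElem_idxOf] using pairwise_iff_getElem.1 h _ _ hi hj hxy

/-- Both lists are sorted for the asymmetric relation `l'.Before`, and a set has only one such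
sorting. -/
theorem Nodup.eq_of_before {l l' : List ℕ} (h : l.Nodup) (h' : l'.Nodup)
    (hmem : ∀ x, x ∈ l ↔ x ∈ l') (hb : ∀ x ∈ l, ∀ y ∈ l, l.Before x y → l'.Before x y) :
    l = l' := by
  refine Perm.eq_of_pairwise (le := l'.Before) (fun a b _ _ h1 h2 => absurd h2 h1.asymm) ?_
    h'.pairwise_before ((perm_ext_iff_of_nodup h h').2 hmem)
  exact h.pairwise_before.imp_of_mem fun hx hy => hb _ hx _ hy

theorem before_insert_iff {A B : List ℕ} {e f u v : ℕ} (hu : u ≠ e) (hv : v ≠ e) :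
    (A ++ e :: f :: B).Before u v ↔ (A ++ f :: B).Before u v := by
  have h1 : ∀ w, w ≠ e → (A ++ e :: f :: B).idxOf w =
      if w ∈ A then A.idxOf w else (f :: B).idxOf w + 1 + A.length := by
    intro w hw
    rw [idxOf_append, idxOf_cons_ne _ hw.symm]
  have h2 : ∀ w, w ∈ A → A.idxOf w < A.length := fun w => idxOf_lt_length_iff.2
  have h3 := h2 u
  have h4 := h2 v
  unfold Before
  rw [h1 u hu, h1 v hv, idxOf_append, idxOf_append]
  grind

theorem before_insert_left_iff {A B : List ℕ} {e f u : ℕ} (hn : (A ++ e :: f :: B).Nodup)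
    (hu : u ≠ e) (hf : u ≠ f) :
    (A ++ e :: f :: B).Before u e ↔ (A ++ f :: B).Before u f := by
  have he : e ∉ A := fun h => by grind
  have hf' : f ∉ A := fun h => by grind
  have h2 : u ∈ A → A.idxOf u < A.length := idxOf_lt_length_iff.2
  unfold Before
  rw [idxOf_append, idxOf_append, idxOf_append, idxOf_append, if_neg he, if_neg hf',
    idxOf_cons_ne _ hu.symm, idxOf_cons_ne _ hf.symm, idxOf_cons_self, idxOf_cons_self]
  grind

theorem before_swap_iff {A B : List ℕ} {x y u v : ℕ} (h : ¬ (u = x ∧ v = y))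
    (h' : ¬ (u = y ∧ v = x)) :
    (A ++ x :: y :: B).Before u v ↔ (A ++ y :: x :: B).Before u v := by
  have h2 : ∀ w, w ∈ A → A.idxOf w < A.length := fun w => idxOf_lt_length_iff.2
  have h3 := h2 u
  have h4 := h2 v
  unfold Before
  by_cases hxy : x = y
  · rw [hxy]
  simp only [idxOf_append, idxOf_cons]
  grind

theorem before_swap {A B : List ℕ} {x y : ℕ} (hn : (A ++ x :: y :: B).Nodup) :
    (A ++ x :: y :: B).Before x y := by
  have hx : x ∉ A := fun h => by grind
  have hy : y ∉ A := fun h => by grind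
  have hxy : x ≠ y := fun h => by grind
  simp [Before, idxOf_append, hx, hy, idxOf_cons_ne _ hxy]

end List

/-! ### Event words -/

/-- The letters of `l` that are at least `m` are increasing, larger than `k` and end with `N`
(there are none of them if `k = N`). -/
def EndsFrom (m N : ℕ) : ℕ → List ℕ → Prop
  | k, [] => k = N
  | k, x :: l => (x < m ∧ EndsFrom m N k l) ∨ (m ≤ x ∧ k < x ∧ EndsFrom m N x l)

namespace EndsFrom

variable {m N : ℕ}

theorem le {k : ℕ} {l : List ℕ} (h : EndsFrom m N k l) : k ≤ N := by
  induction l generalizing k with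
  | nil => exact Nat.le_of_eq h
  | cons x l ih =>
    rcases h with ⟨-, h⟩ | ⟨-, h1, h⟩
    · exact ih h
    · exact h1.le.trans (ih h)

theorem bounds {k : ℕ} {l : List ℕ} (h : EndsFrom m N k l) {x : ℕ} (hx : x ∈ l) (hm : m ≤ x) :
    k < x ∧ x ≤ N := by
  induction l generalizing k with
  | nil => simp at hx
  | cons y l ih =>
    rcases h with ⟨h1, h⟩ | ⟨-, h1, h⟩ <;> rcases List.mem_cons.1 hx with rfl | hx
    · omega
    · exact ih h hx
    · exact ⟨h1, h.le⟩
    · exact ⟨h1.trans (ih h hx).1, (ih h hx).2⟩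

theorem last_mem {k : ℕ} {l : List ℕ} (h : EndsFrom m N k l) (hk : k < N) : N ∈ l := by
  induction l generalizing k with
  | nil => exact absurd h hk.ne
  | cons y l ih =>
    rcases h with ⟨h1, h⟩ | ⟨-, h1, h⟩
    · exact List.mem_cons_of_mem _ (ih h hk)
    · rcases h.le.eq_or_lt with rfl | h2
      · exact List.mem_cons_self
      · exact List.mem_cons_of_mem _ (ih h h2)

theorem pairwise {k : ℕ} {l : List ℕ} (h : EndsFrom m N k l) :
    l.Pairwise fun x y => m ≤ x → m ≤ y → x < y := by
  induction l generalizing k with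
  | nil => exact List.Pairwise.nil
  | cons y l ih =>
    rcases h with ⟨h1, h⟩ | ⟨-, h1, h⟩
    · exact List.Pairwise.cons (fun z _ h2 => by omega) (ih h)
    · exact List.Pairwise.cons (fun z hz _ h3 => (h.bounds hz h3).1) (ih h)

theorem of_pairwise {k : ℕ} {l : List ℕ} (hm : m ≤ N)
    (hp : l.Pairwise fun x y => m ≤ x → m ≤ y → x < y)
    (hb : ∀ x ∈ l, m ≤ x → k < x ∧ x ≤ N) (hN : k = N ∨ N ∈ l) : EndsFrom m N k l := by
  induction l generalizing k with
  | nil => exact hN.resolve_right List.not_mem_nil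
  | cons y l ih =>
    have hb' := fun x hx => hb x (List.mem_cons_of_mem _ hx)
    obtain ⟨hp1, hp2⟩ := List.pairwise_cons.1 hp
    rcases lt_or_ge y m with hy | hy
    · refine Or.inl ⟨hy, ih hp2 hb' (hN.imp_right fun h => ?_)⟩
      exact (List.mem_cons.1 h).resolve_left (by omega)
    · obtain ⟨h1, h2⟩ := hb y List.mem_cons_self hy
      refine Or.inr ⟨hy, h1, ih hp2 (fun x hx hx' => ⟨hp1 x hx hy hx', (hb' x hx hx').2⟩) ?_⟩
      rcases hN with rfl | h
      · omega
      · exact (List.mem_cons.1 h).imp_left Eq.symm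

theorem count_le_one {k : ℕ} {l : List ℕ} (h : EndsFrom m N k l) {x : ℕ} (hx : m ≤ x) :
    l.count x ≤ 1 := by
  induction l generalizing k with
  | nil => simp
  | cons y l ih =>
    rcases h with ⟨h1, h⟩ | ⟨-, -, h⟩
    · rw [List.count_cons_of_ne (by omega)]
      exact ih h
    · by_cases hxy : y = x
      · subst hxy
        rw [List.count_cons_self, List.count_eq_zero_of_not_mem]
        exact fun hz => lt_irrefl _ (h.bounds hz hx).1
      · rw [List.count_cons_of_ne hxy]
        exact ih h

end EndsFrom

/-- Event words encode unary `m`-lighted `n`-shades.  The letters `x < m` stand for the cuts with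
label `x`, and a letter `m + e` stands for a singleton whose last unit is the `e`-th one among the
`n` units of the shade. -/
structure EventWord (m n : ℕ) where
  letters : List ℕ
  ends : EndsFrom m (m + n) m letters
  count_label : ∀ x < m, letters.count x = 1

namespace EventWord

variable {m n : ℕ}

theorem nodup (s : EventWord m n) : s.letters.Nodup :=
  List.nodup_iff_count_le_one.2 fun x =>
    (lt_or_ge x m).elim (fun h => (s.count_label x h).le) s.ends.count_le_one

theorem label_mem (s : EventWord m n) {x : ℕ} (hx : x < m) : x ∈ s.letters :=
  List.count_pos_iff.1 (by rw [s.count_label x hx]; exact Nat.one_pos)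

theorem bounds (s : EventWord m n) {x : ℕ} (hx : x ∈ s.letters) (hm : m ≤ x) :
    m < x ∧ x ≤ m + n :=
  s.ends.bounds hx hm

theorem last_mem (s : EventWord m n) (hn : 0 < n) : m + n ∈ s.letters :=
  s.ends.last_mem (by omega)

theorem before_of_lt (s : EventWord m n) {x y : ℕ} (hx : m ≤ x) (hxy : x < y)
    (hxs : x ∈ s.letters) : s.letters.Before x y :=
  (List.before_or_before hxs hxy.ne).resolve_right fun h =>
    (s.ends.pairwise.rel_of_before hxs h (by omega) hx).not_gt hxy

@[ext]
theorem ext {s t : EventWord m n} (h : s.letters = t.letters) : s = t := by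
  cases s
  cases t
  congr

/-- The letter `e` accounts for `y` if `e = y`, or if `y` is one of the units up to `e`. -/
def Covers (m e y : ℕ) : Prop :=
  e = y ∨ m ≤ y ∧ y ≤ e

/-- The pairs `x < y` with `x` above `y`. -/
def Noninv (s : EventWord m n) (x y : ℕ) : Prop :=
  x < y ∧ (x < m → ∀ e ∈ s.letters, Covers m e y → s.letters.Before x e)

/-- If `y` is a label, compare through its own letter. If `y` is at least `m`, every letter covering
`z` also covers `y`. -/
theorem noninv_trans (s : EventWord m n) {x y z : ℕ} (h : s.Noninv x y) (h' : s.Noninv y z) :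
    s.Noninv x z := by
  refine ⟨h.1.trans h'.1, fun hx e he hez => ?_⟩
  rcases lt_or_ge y m with hy | hy
  · exact (h.2 hx y (s.label_mem hy) (Or.inl rfl)).trans (h'.2 hy e he hez)
  · have h1 := h'.1
    exact h.2 hx e he (Or.inr (by unfold Covers at hez; omega))

/-- A label `y` is either below `x`, or above `x` and hence above all that `x` precedes. If `y` is
not a label, the pair `y < z` is a noninversion by convention. -/
theorem noninv_cotrans (s : EventWord m n) {x y z : ℕ} (hxy : x < y) (hyz : y < z)
    (h : s.Noninv x z) : s.Noninv x y ∨ s.Noninv y z := by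
  rcases lt_or_ge y m with hy | hy
  · rcases List.before_or_before (s.label_mem (hxy.trans hy)) hxy.ne with h1 | h1
    · refine Or.inl ⟨hxy, fun hx e he hey => ?_⟩
      obtain rfl : e = y := by unfold Covers at hey; omega
      exact h1
    · exact Or.inr ⟨hyz, fun _ e he hez => h1.trans (h.2 (hxy.trans hy) e he hez)⟩
  · exact Or.inr ⟨hyz, fun h' => by omega⟩

theorem noninv_iff_before (s : EventWord m n) {x y : ℕ} (hxy : x < y) (hx : x ∈ s.letters)
    (hy : y ∈ s.letters) : s.Noninv x y ↔ s.letters.Before x y := by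
  refine ⟨fun h => ?_, fun h => ⟨hxy, fun _ e he hey => ?_⟩⟩
  · rcases lt_or_ge x m with hm | hm
    · exact h.2 hm y hy (Or.inl rfl)
    · exact s.before_of_lt hm hxy hx
  · rcases eq_or_ne e y with rfl | h1
    · exact h
    · unfold Covers at hey
      exact h.trans (s.before_of_lt (by omega) (by omega) hy)

theorem letters_before_iff {s t : EventWord m n} (hmem : ∀ x, x ∈ s.letters ↔ x ∈ t.letters)
    (h : ∀ x y, s.Noninv x y ↔ t.Noninv x y) {x y : ℕ} (hx : x ∈ s.letters) (hy : y ∈ s.letters) :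
    s.letters.Before x y → t.letters.Before x y := by
  intro hb
  rcases lt_trichotomy x y with hxy | rfl | hxy
  · rwa [← t.noninv_iff_before hxy ((hmem x).1 hx) ((hmem y).1 hy), ← h,
      s.noninv_iff_before hxy hx hy]
  · exact absurd hb hb.asymm
  · refine (List.before_or_before ((hmem x).1 hx) hxy.ne').resolve_right fun h1 => hb.asymm ?_
    rwa [← s.noninv_iff_before hxy hy hx, h,
      t.noninv_iff_before hxy ((hmem y).1 hy) ((hmem x).1 hx)]

theorem eq_of_noninv {s t : EventWord m n} (hmem : ∀ x, x ∈ s.letters ↔ x ∈ t.letters)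
    (h : ∀ x y, s.Noninv x y ↔ t.Noninv x y) : s = t :=
  EventWord.ext (s.nodup.eq_of_before t.nodup hmem fun _ hx _ hy => letters_before_iff hmem h hx hy)

instance : PartialOrder (EventWord m n) where
  le s t := (∀ x ∈ s.letters, x ∈ t.letters) ∧ ∀ x y, s.Noninv x y → t.Noninv x y
  le_refl s := ⟨fun _ h => h, fun _ _ h => h⟩
  le_trans s t u h h' := ⟨fun x hx => h'.1 x (h.1 x hx), fun x y hx => h'.2 x y (h.2 x y hx)⟩
  le_antisymm s t h h' :=
    eq_of_noninv (fun x => ⟨h.1 x, h'.1 x⟩) fun x y => ⟨h.2 x y, h'.2 x y⟩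

/-- Between words with the same letters, the order only depends on the pairs of letters. -/
theorem le_of_before {s t : EventWord m n} (hmem : ∀ x, x ∈ s.letters ↔ x ∈ t.letters)
    (h : ∀ x ∈ s.letters, ∀ y ∈ s.letters, x < m → x < y → s.letters.Before x y →
      t.letters.Before x y) : s ≤ t := by
  refine ⟨fun x => (hmem x).1, fun x y hxy => ⟨hxy.1, fun hx e he hey => ?_⟩⟩
  have h1 := hxy.1
  refine h x (s.label_mem hx) e ((hmem e).2 he) hx ?_ (hxy.2 hx e ((hmem e).2 he) hey)
  unfold Covers at hey
  omega

instance : Finite (EventWord m n) := by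
  let K := m + n + 1
  have hK : ∀ (s : EventWord m n) x, x ∈ s.letters → x < K := fun s x hx =>
    (lt_or_ge x m).elim (fun h => by omega) fun h => Nat.lt_succ_of_le (s.bounds hx h).2
  let f : EventWord m n → Set (Fin K) × Set (Fin K × Fin K) := fun s =>
    ({x | x.1 ∈ s.letters}, {p | s.letters.Before p.1 p.2})
  refine Finite.of_injective f fun s t hst => ?_
  obtain ⟨h1, h2⟩ := Prod.mk.inj hst
  have hmem : ∀ x, x ∈ s.letters ↔ x ∈ t.letters := fun x =>
    ⟨fun hx => (Set.ext_iff.1 h1 ⟨x, hK s x hx⟩).1 hx,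
      fun hx => (Set.ext_iff.1 h1 ⟨x, hK t x hx⟩).2 hx⟩
  exact EventWord.ext (s.nodup.eq_of_before t.nodup hmem fun x hx y hy =>
    (Set.ext_iff.1 h2 (⟨x, hK s x hx⟩, ⟨y, hK s y hy⟩)).1)

end EventWord

/-- The right rotations on the letters of event words. -/
inductive WordStep (m : ℕ) : List ℕ → List ℕ → Prop
  | insert (A B : List ℕ) (e f : ℕ) (he : m < e) (hef : e < f) :
      WordStep m (A ++ f :: B) (A ++ e :: f :: B)
  | swap (A B : List ℕ) (x y : ℕ) (hx : x < m) (hxy : x < y) :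
      WordStep m (A ++ y :: x :: B) (A ++ x :: y :: B)

/-! ### Rotations as cover relations -/

namespace EndsFrom

variable {m N : ℕ}

theorem swap {k : ℕ} {A B : List ℕ} {x y : ℕ} (h : EndsFrom m N k (A ++ y :: x :: B))
    (hx : x < m) : EndsFrom m N k (A ++ x :: y :: B) := by
  induction A generalizing k with
  | nil =>
    rcases h with ⟨hy, ⟨-, h⟩ | ⟨h, -⟩⟩ | ⟨hy, hk, ⟨-, h⟩ | ⟨h, -⟩⟩
    · exact Or.inl ⟨hx, Or.inl ⟨hy, h⟩⟩
    · omega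
    · exact Or.inl ⟨hx, Or.inr ⟨hy, hk, h⟩⟩
    · omega
  | cons z A ih => exact h.imp (And.imp_right ih) (And.imp_right (And.imp_right ih))

/-- The letter `f` is the first end larger than `e`. Placing `e` directly before it makes the
insertion a split of one singleton, with no cut between the two pieces. -/
theorem exists_insert {k : ℕ} {l : List ℕ} (h : EndsFrom m N k l) {e : ℕ} (he : m < e)
    (hk : k < e) (heN : e ≤ N) (hel : e ∉ l) :
    ∃ A f B, l = A ++ f :: B ∧ e < f ∧ EndsFrom m N k (A ++ e :: f :: B) := by
  induction l generalizing k with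
  | nil =>
    have h' : k = N := h
    omega
  | cons y l ih =>
    obtain ⟨hey, hel⟩ := List.ne_and_not_mem_of_not_mem_cons hel
    rcases h with ⟨hy, h⟩ | ⟨hy, hky, h⟩
    · obtain ⟨A, f, B, rfl, hf, h'⟩ := ih h hk hel
      exact ⟨y :: A, f, B, rfl, hf, Or.inl ⟨hy, h'⟩⟩
    · rcases lt_or_gt_of_ne hey with hey | hey
      · exact ⟨[], y, l, rfl, hey, Or.inr ⟨he.le, hk, Or.inr ⟨hy, hey, h⟩⟩⟩
      · obtain ⟨A, f, B, rfl, hf, h'⟩ := ih h hey hel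
        exact ⟨y :: A, f, B, rfl, hf, Or.inr ⟨hy, hky, h'⟩⟩

end EndsFrom

namespace EventWord

variable {m n : ℕ}

theorem before_of_le {s t : EventWord m n} (h : s ≤ t) {x y : ℕ} (hx : x ∈ s.letters)
    (hy : y ∈ s.letters) (hxy : x < y) (hb : s.letters.Before x y) : t.letters.Before x y :=
  (t.noninv_iff_before hxy (h.1 x hx) (h.1 y hy)).1
    (h.2 x y ((s.noninv_iff_before hxy hx hy).2 hb))

/-- Whatever `e` covers is also covered by `f`, and a cut precedes `e` exactly when it precedes `f`.
-/
theorem noninv_insert_iff {s t : EventWord m n} {A B : List ℕ} {e f : ℕ} (he : m < e)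
    (hef : e < f) (hs : s.letters = A ++ f :: B) (ht : t.letters = A ++ e :: f :: B) (x y : ℕ) :
    s.Noninv x y ↔ t.Noninv x y := by
  have hmem : ∀ g, g ∈ t.letters ↔ g = e ∨ g ∈ s.letters := by
    intro g
    simp only [hs, ht, List.mem_append, List.mem_cons]
    tauto
  have hes : e ∉ s.letters := by
    have := t.nodup
    rw [ht] at this
    rw [hs]
    grind
  have hn := t.nodup
  rw [ht] at hn
  have hb : ∀ g, x < m → g ∈ s.letters → (t.letters.Before x g ↔ s.letters.Before x g) := by
    intro g hx hg
    rw [hs, ht]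
    exact List.before_insert_iff (by omega) (fun h => hes (h ▸ hg))
  have hb' : x < m → (t.letters.Before x e ↔ s.letters.Before x f) := by
    intro hx
    rw [hs, ht]
    exact List.before_insert_left_iff hn (by omega) (by omega)
  refine and_congr_right fun _ => forall_congr' fun hx => ⟨fun h g hg hc => ?_, fun h g hg hc => ?_⟩
  · rcases (hmem g).1 hg with rfl | hg
    · exact (hb' hx).2 (h f (by simp [hs]) (by unfold Covers at *; omega))
    · exact (hb g hx hg).2 (h g hg hc)
  · exact (hb g hx hg).1 (h g ((hmem g).2 (Or.inr hg)) hc)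

theorem mem_swap {A B : List ℕ} {x y z : ℕ} : z ∈ A ++ y :: x :: B ↔ z ∈ A ++ x :: y :: B := by
  simp only [List.mem_append, List.mem_cons]
  tauto

/-- An insertion adds one letter and no noninversion, so a word in between has one of the two letter
sets and the same noninversions. A swap changes the order of a single pair of letters; a word in
between agrees with one side on that pair, hence equals that side. -/
theorem covBy_of_wordStep {s t : EventWord m n} (h : WordStep m s.letters t.letters) : s ⋖ t := by
  generalize hs : s.letters = l at h
  generalize ht : t.letters = l' at h
  cases h with
  | insert A B e f he hef =>
    have hN := noninv_insert_iff he hef hs ht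
    have hmem : ∀ g, g ∈ t.letters ↔ g = e ∨ g ∈ s.letters := by
      intro g
      simp only [hs, ht, List.mem_append, List.mem_cons]
      tauto
    have hes : e ∉ s.letters := by
      have := t.nodup
      rw [ht] at this
      rw [hs]
      grind
    refine ⟨lt_of_le_not_ge ⟨fun x hx => (hmem x).2 (Or.inr hx), fun x y => (hN x y).1⟩
      fun h => hes (h.1 e ((hmem e).2 (Or.inl rfl))), fun u hsu hut => ?_⟩
    by_cases heu : e ∈ u.letters
    · refine hut.not_ge ⟨fun x hx => ?_, fun x y hxy => hsu.le.2 x y ((hN x y).2 hxy)⟩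
      rcases (hmem x).1 hx with rfl | hx
      · exact heu
      · exact hsu.le.1 x hx
    · refine hsu.not_ge ⟨fun x hx => ?_, fun x y hxy => (hN x y).2 (hut.le.2 x y hxy)⟩
      exact ((hmem x).1 (hut.le.1 x hx)).resolve_left fun h => heu (h ▸ hx)
  | swap A B x y hx hxy =>
    have hmem : ∀ g, g ∈ s.letters ↔ g ∈ t.letters := fun g => by rw [hs, ht, mem_swap]
    have hsyx : s.letters.Before y x := by
      rw [hs]
      exact List.before_swap (hs ▸ s.nodup)
    have htxy : t.letters.Before x y := by
      rw [ht]
      exact List.before_swap (ht ▸ t.nodup)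
    have hb : ∀ a b, a < b → ¬ (a = x ∧ b = y) → (s.letters.Before a b ↔ t.letters.Before a b) := by
      intro a b hab h
      rw [hs, ht]
      exact List.before_swap_iff (by omega) h
    have hst : s ≤ t := by
      refine le_of_before hmem fun a _ b _ _ hab h => ?_
      by_cases h' : a = x ∧ b = y
      · obtain ⟨rfl, rfl⟩ := h'
        exact htxy
      · exact (hb a b hab h').1 h
    have hy : y ∈ s.letters := by simp [hs]
    refine ⟨lt_of_le_of_ne hst fun h => hsyx.asymm (h ▸ htxy), fun u hsu hut => ?_⟩
    have hmu : ∀ g, g ∈ s.letters ↔ g ∈ u.letters := fun g =>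
      ⟨hsu.le.1 g, fun hg => (hmem g).2 (hut.le.1 g hg)⟩
    by_cases hu : u.letters.Before x y
    · refine hut.not_ge (le_of_before (fun g => (hmem g).symm.trans (hmu g))
        fun a ha b hb' _ hab h => ?_)
      by_cases h' : a = x ∧ b = y
      · obtain ⟨rfl, rfl⟩ := h'
        exact hu
      · exact before_of_le hsu.le ((hmem a).2 ha) ((hmem b).2 hb') hab ((hb a b hab h').2 h)
    · refine hsu.not_ge (le_of_before (fun g => (hmu g).symm) fun a ha b hb' _ hab h => ?_)
      by_cases h' : a = x ∧ b = y
      · obtain ⟨rfl, rfl⟩ := h'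
        exact absurd h hu
      · exact (hb a b hab h').2 (before_of_le hut.le ha hb' hab h)

/-- With equal letter sets, some adjacent pair of `s` is reversed in `t`, since otherwise `s` would
be sorted as `t` is; swapping it stays below `t`. Otherwise, inserting a missing end of `t` costs no
noninversion. -/
theorem exists_wordStep_of_lt {s t : EventWord m n} (h : s < t) :
    ∃ u : EventWord m n, WordStep m s.letters u.letters ∧ u ≤ t := by
  by_cases hts : ∀ x ∈ t.letters, x ∈ s.letters
  · have hmem : ∀ x, x ∈ s.letters ↔ x ∈ t.letters := fun x => ⟨h.le.1 x, hts x⟩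
    have hnc : ¬ s.letters.IsChain t.letters.Before := by
      intro hc
      have : Trans t.letters.Before t.letters.Before t.letters.Before := ⟨List.Before.trans⟩
      have hp := List.isChain_iff_pairwise.1 hc
      exact h.ne (EventWord.ext (s.nodup.eq_of_before t.nodup hmem
        fun x _ y hy hxy => hp.rel_of_before hy hxy))
    rw [List.isChain_iff_forall_rel_of_append_cons_cons] at hnc
    push Not at hnc
    obtain ⟨a, b, A, B, hs, hab⟩ := hnc
    have ha : a ∈ s.letters := by simp [hs]
    have hb : b ∈ s.letters := by simp [hs]
    have hsab : s.letters.Before a b := by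
      rw [hs]
      exact List.before_swap (hs ▸ s.nodup)
    have hne : a ≠ b := by
      rintro rfl
      exact hsab.asymm hsab
    have htba := (List.before_or_before ((hmem a).1 ha) hne).resolve_left hab
    have hba : b < a := by
      by_contra hlt
      exact hab (before_of_le h.le ha hb (by omega) hsab)
    have hbm : b < m := by
      by_contra hlt
      exact hsab.asymm (s.before_of_lt (by omega) hba hb)
    let u : EventWord m n := ⟨A ++ b :: a :: B, (hs ▸ s.ends).swap hbm, fun x hx => by
      rw [← s.count_label x hx, hs]
      exact (List.Perm.append_left A (List.Perm.swap _ _ _)).count_eq x⟩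
    refine ⟨u, hs ▸ WordStep.swap A B b a hbm hba, ?_⟩
    have hmu : ∀ g, g ∈ u.letters ↔ g ∈ s.letters := fun g => by rw [hs]; exact mem_swap
    refine le_of_before (fun g => (hmu g).trans (hmem g)) fun x hx y hy _ hxy hu => ?_
    by_cases h' : x = b ∧ y = a
    · obtain ⟨rfl, rfl⟩ := h'
      exact htba
    · refine before_of_le h.le ((hmu x).1 hx) ((hmu y).1 hy) hxy ?_
      rw [hs]
      exact (List.before_swap_iff h' (by omega)).1 hu
  · push Not at hts
    obtain ⟨e, het, hes⟩ := hts
    have hm : m ≤ e := le_of_not_gt fun hlt => hes (s.label_mem hlt)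
    obtain ⟨h1, h2⟩ := t.bounds het hm
    obtain ⟨A, f, B, hs, hf, hE⟩ := s.ends.exists_insert h1 h1 h2 hes
    let u : EventWord m n := ⟨A ++ e :: f :: B, hE, fun x hx => by
      rw [← s.count_label x hx, hs, List.count_append, List.count_append,
        List.count_cons_of_ne (by omega)]⟩
    refine ⟨u, hs ▸ WordStep.insert A B e f h1 hf, fun x hx => ?_, fun x y hxy => ?_⟩
    · by_cases hxe : x = e
      · exact hxe ▸ het
      · have hx' : x ∈ A ++ e :: f :: B := hx
        refine h.le.1 x ?_
        rw [hs]
        simp only [List.mem_append, List.mem_cons] at hx' ⊢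
        tauto
    · exact h.le.2 x y ((noninv_insert_iff (t := u) h1 hf hs rfl x y).2 hxy)

theorem reflTransGen_iff_le {s t : EventWord m n} :
    Relation.ReflTransGen (fun u v : EventWord m n => WordStep m u.letters v.letters) s t ↔
      s ≤ t := by
  constructor
  · intro h
    induction h with
    | refl => exact le_rfl
    | tail _ h ih => exact ih.trans (covBy_of_wordStep h).le
  · induction s using WellFoundedGT.induction with
    | ind s ih =>
      intro h
      rcases h.eq_or_lt with rfl | h
      · exact Relation.ReflTransGen.refl
      · obtain ⟨u, hu, hut⟩ := exists_wordStep_of_lt h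
        exact (ih u (covBy_of_wordStep hu).lt hut).head hu

theorem covBy_iff_wordStep {s t : EventWord m n} : s ⋖ t ↔ WordStep m s.letters t.letters := by
  refine ⟨fun h => ?_, covBy_of_wordStep⟩
  obtain ⟨u, hu, hut⟩ := exists_wordStep_of_lt h.lt
  rcases hut.eq_or_lt with rfl | hut
  · exact hu
  · exact absurd hut (h.2 (covBy_of_wordStep hu).lt)

/-! ### Event words from relations -/

-- Transitivity and cotransitivity say that `J` and its complement among increasing pairs are both
-- transitive, so `R` is a total order and sorting `X` by it gives the word. Only the values of `J`
-- on `X` survive, hence the form of the conclusion.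
open Classical in
theorem exists_of_rel (X : Finset ℕ) (J : ℕ → ℕ → Prop) (hlab : ∀ x < m, x ∈ X)
    (hX : ∀ x ∈ X, m ≤ x → m < x ∧ x ≤ m + n) (hn : 0 < n → m + n ∈ X)
    (hJ : ∀ x y, J x y → x < y) (hJm : ∀ x y, m ≤ x → x < y → J x y)
    (htrans : ∀ x y z, J x y → J y z → J x z)
    (hcotrans : ∀ x y z, x < y → y < z → J x z → J x y ∨ J y z) :
    ∃ s : EventWord m n, (∀ x, x ∈ s.letters ↔ x ∈ X) ∧
      ∀ x y, s.Noninv x y ↔ x < y ∧ (x < m → ∀ e ∈ X, Covers m e y → J x e) := by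
  let R : ℕ → ℕ → Prop := fun x y => x = y ∨ J x y ∨ (y < x ∧ ¬ J y x)
  have hR : ∀ {x y}, x < y → (R x y ↔ J x y) := by
    intro x y hxy
    simp only [R]
    constructor
    · rintro (h | h | ⟨h, -⟩)
      · omega
      · exact h
      · omega
    · exact fun h => Or.inr (Or.inl h)
  have : Std.Total R := ⟨fun x y => by
    rcases lt_trichotomy x y with h | h | h
    · by_cases h' : J x y
      · exact Or.inl (Or.inr (Or.inl h'))
      · exact Or.inr (Or.inr (Or.inr ⟨h, h'⟩))
    · exact Or.inl (Or.inl h)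
    · by_cases h' : J y x
      · exact Or.inr (Or.inr (Or.inl h'))
      · exact Or.inl (Or.inr (Or.inr ⟨h, h'⟩))⟩
  have : IsTrans ℕ R := ⟨fun x y z h h' => by
    have h1 := hJ x y
    have h2 := hJ y z
    have h3 := htrans x y z
    have h4 := htrans y z x
    have h5 := htrans z x y
    have h6 := hcotrans x z y
    have h7 := hcotrans y x z
    have h8 := hcotrans z y x
    have h9 := hJ z x
    grind⟩
  let l := X.toList.insertionSort R
  have hperm : l.Perm X.toList := List.perm_insertionSort R _
  have hnd : l.Nodup := hperm.nodup_iff.2 X.nodup_toList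
  have hmem : ∀ x, x ∈ l ↔ x ∈ X := fun x => by rw [hperm.mem_iff, Finset.mem_toList]
  have hpw : l.Pairwise R := List.pairwise_insertionSort R _
  have hE : EndsFrom m (m + n) m l := by
    refine EndsFrom.of_pairwise (by omega) ?_ (fun x hx => hX x ((hmem x).1 hx)) ?_
    · refine (hpw.and hnd).imp ?_
      rintro x y ⟨hxy, hne⟩ hx hy
      by_contra hlt
      rcases hxy with h | h | h
      · exact hne h
      · exact hlt (hJ x y h)
      · exact h.2 (hJm y x hy h.1)
    · rw [hmem]
      rcases Nat.eq_zero_or_pos n with h | h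
      · exact Or.inl (by omega)
      · exact Or.inr (hn h)
  let s : EventWord m n :=
    ⟨l, hE, fun x hx => List.count_eq_one_of_mem hnd ((hmem x).2 (hlab x hx))⟩
  have hbef : ∀ x ∈ X, ∀ y ∈ X, x < y → (l.Before x y ↔ J x y) := by
    intro x hx y hy hxy
    refine ⟨fun h => (hR hxy).1 (hpw.rel_of_before ((hmem y).2 hy) h), fun h => ?_⟩
    refine (List.before_or_before ((hmem x).2 hx) hxy.ne).resolve_right fun h' => ?_
    rcases hpw.rel_of_before ((hmem x).2 hx) h' with h1 | h1 | h1
    · omega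
    · exact hxy.not_gt (hJ y x h1)
    · exact h1.2 h
  refine ⟨s, hmem, fun x y => and_congr_right fun hxy => forall_congr' fun hx =>
    forall_congr' fun e => ?_⟩
  rw [show e ∈ s.letters ↔ e ∈ X from hmem e]
  refine forall_congr' fun he => forall_congr' fun hc => hbef x (hlab x hx) e he ?_
  unfold Covers at hc
  omega

/-! ### Bottom, joins and meets -/

theorem exists_bot : ∃ s : EventWord m n, ∀ t, s ≤ t := by
  let X : Finset ℕ := Finset.range m ∪ if 0 < n then {m + n} else ∅
  have hX : ∀ x, x ∈ X ↔ x < m ∨ (0 < n ∧ x = m + n) := by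
    intro x
    simp only [X, Finset.mem_union, Finset.mem_range]
    split_ifs <;> simp_all
  -- This `J` puts the whole of `n` into one singleton at the top, followed by the cuts with
  -- decreasing labels.
  obtain ⟨s, hs, hN⟩ := exists_of_rel (m := m) (n := n) X (fun x y => m ≤ x ∧ x < y)
    (fun x hx => (hX x).2 (Or.inl hx)) (fun x hx hm => by have := (hX x).1 hx; omega)
    (fun h => (hX _).2 (Or.inr ⟨h, rfl⟩)) (fun x y h => h.2) (fun x y h h' => ⟨h, h'⟩)
    (fun x y z h h' => ⟨h.1, h.2.trans h'.2⟩) (fun x y z h h' h'' => Or.inl ⟨h''.1, h⟩)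
  refine ⟨s, fun t => ⟨fun x hx => ?_, fun x y hxy => ⟨hxy.1, fun hx e he hc => ?_⟩⟩⟩
  · rcases (hX x).1 ((hs x).1 hx) with h | ⟨h, rfl⟩
    · exact t.label_mem h
    · exact t.last_mem h
  -- No letter of `s` follows a label `x < y` in the sense of `J`, so the noninversion could only be
  -- vacuous; but a letter of `t` covering `y` yields one of `s`.
  · exfalso
    have h := ((hN x y).1 hxy).2 hx
    rcases lt_or_ge e m with hem | hem
    · exact absurd (h e ((hX e).2 (Or.inl hem)) hc).1 hx.not_ge
    · have hb := t.bounds he hem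
      refine absurd (h (m + n) ((hX _).2 (Or.inr ⟨by omega, rfl⟩)) ?_).1 hx.not_ge
      unfold Covers at *
      omega

/-- The transitive closure `J` lies in the noninversions of every upper bound. The delicate point is
that the word built from `J` has no others except vacuous ones: its noninversions are read at the
letters of `X`, and must be brought back to units that are not letters. -/
theorem exists_isLUB_pair (s t : EventWord m n) :
    ∃ u : EventWord m n, s ≤ u ∧ t ≤ u ∧ ∀ v, s ≤ v → t ≤ v → u ≤ v := by
  let X := s.letters.toFinset ∪ t.letters.toFinset
  have hX : ∀ x, x ∈ X ↔ x ∈ s.letters ∨ x ∈ t.letters := by simp [X]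
  let J₀ : ℕ → ℕ → Prop := fun x y => s.Noninv x y ∨ t.Noninv x y
  let J := Relation.TransGen J₀
  have hJ₀ : ∀ x y, J₀ x y → x < y := fun x y h => h.elim And.left And.left
  have hJ : ∀ x y, J x y → x < y := fun x y h => by
    induction h with
    | single h => exact hJ₀ _ _ h
    | tail _ h ih => exact ih.trans (hJ₀ _ _ h)
  have hJ₀c : ∀ x y z, x < y → y < z → J₀ x z → J₀ x y ∨ J₀ y z := by
    rintro x y z h h' (h1 | h1)
    · exact (s.noninv_cotrans h h' h1).imp Or.inl Or.inl
    · exact (t.noninv_cotrans h h' h1).imp Or.inr Or.inr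
  -- A chain from `x` to `z` either visits `y` or jumps over it in one step, and cotransitivity of
  -- `J₀` cuts that step at `y`.
  have hJc : ∀ x y z, x < y → y < z → J x z → J x y ∨ J y z := by
    intro x y z hxy hyz h
    induction h using Relation.TransGen.head_induction_on with
    | single h => exact (hJ₀c _ _ _ hxy hyz h).imp .single .single
    | @head x w hxw hwz ih =>
      rcases lt_trichotomy y w with hyw | rfl | hyw
      · exact (hJ₀c _ _ _ hxy hyw hxw).imp .single fun h => .head h hwz
      · exact Or.inr hwz
      · exact (ih hyw).imp_left fun h => .head hxw h
  obtain ⟨u, hu, hN⟩ := exists_of_rel (m := m) (n := n) X J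
    (fun x hx => (hX x).2 (Or.inl (s.label_mem hx)))
    (fun x hx hm => ((hX x).1 hx).elim (fun h => s.bounds h hm) fun h => t.bounds h hm)
    (fun h => (hX _).2 (Or.inl (s.last_mem h))) hJ
    (fun x y h h' => .single (Or.inl ⟨h', fun h'' => by omega⟩)) (fun x y z h h' => h.trans h')
    hJc
  have hJ₀J : ∀ x y, J₀ x y → u.Noninv x y := by
    refine fun x y h => (hN x y).2 ⟨hJ₀ x y h, fun hx e he hc => ?_⟩
    rcases eq_or_ne e y with rfl | hne
    · exact .single h
    · unfold Covers at hc
      exact .tail (.single h) (Or.inl ⟨by omega, fun h' => by omega⟩)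
  refine ⟨u, ⟨fun x hx => (hu x).2 ((hX x).2 (Or.inl hx)), fun x y h => hJ₀J x y (Or.inl h)⟩,
    ⟨fun x hx => (hu x).2 ((hX x).2 (Or.inr hx)), fun x y h => hJ₀J x y (Or.inr h)⟩,
    fun v hs ht => ⟨fun x hx => ((hX x).1 ((hu x).1 hx)).elim (hs.1 x) (ht.1 x), ?_⟩⟩
  have hJv : ∀ x y, J x y → v.Noninv x y := fun x y h => by
    induction h with
    | single h => exact h.elim (hs.2 _ _) (ht.2 _ _)
    | tail _ h ih => exact v.noninv_trans ih (h.elim (hs.2 _ _) (ht.2 _ _))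
  intro x y hxy
  have hlt := hxy.1
  have hcov := ((hN x y).1 hxy).2
  rcases lt_or_ge x m with hx | hx
  swap
  · exact ⟨hlt, fun h => by omega⟩
  -- In the second alternative no letter of any word covers `y`, and the noninversion holds
  -- vacuously.
  suffices h : J x y ∨ (m ≤ y ∧ (n = 0 ∨ m + n < y)) by
    rcases h with h | h
    · exact hJv x y h
    · refine ⟨hlt, fun _ e he hc => ?_⟩
      unfold Covers at hc
      have := v.bounds he (by omega)
      omega
  rcases lt_or_ge y m with hy | hy
  · exact Or.inl (hcov hx y ((hX y).2 (Or.inl (s.label_mem hy))) (Or.inl rfl))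
  by_cases hex : ∃ e, e ∈ X ∧ y ≤ e
  swap
  · refine Or.inr ⟨hy, n.eq_zero_or_pos.imp_right fun h0 => lt_of_not_ge fun hle => ?_⟩
    exact hex ⟨m + n, (hX _).2 (Or.inl (s.last_mem h0)), hle⟩
  left
  classical
  obtain ⟨he, hye⟩ := Nat.find_spec hex
  have hmin := fun e (h : e < Nat.find hex) => Nat.find_min hex h
  set e := Nat.find hex
  have hxe : J x e := hcov hx e he (Or.inr ⟨hy, hye⟩)
  -- As `e` is the least letter of `X` from `y` on, any letter of `w` covering `y` is at least `e`,
  -- so it also covers `z`.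
  have hpull : ∀ w : EventWord m n, (∀ g ∈ w.letters, g ∈ X) → ∀ b z, b < y → y ≤ z → z ≤ e →
      w.Noninv b z → w.Noninv b y := by
    refine fun w hw b z hb hyz hze h => ⟨hb, fun hbm g hg hc => h.2 hbm g hg (Or.inr ?_)⟩
    have hge : e ≤ g := by
      refine Nat.find_min' hex ⟨hw g hg, ?_⟩
      unfold Covers at hc
      omega
    omega
  have hpull₀ : ∀ b z, b < y → y ≤ z → z ≤ e → J₀ b z → J₀ b y := fun b z hb hyz hze h =>
    h.imp (hpull s (fun g hg => (hX g).2 (Or.inl hg)) b z hb hyz hze)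
      (hpull t (fun g hg => (hX g).2 (Or.inr hg)) b z hb hyz hze)
  -- Walk back along the chain to the step that crosses `y`, and redirect that step to end at `y`.
  have key : ∀ z, J x z → y ≤ z → z ≤ e → J x y := by
    intro z h
    induction h with
    | single h => exact fun h1 h2 => .single (hpull₀ _ _ hlt h1 h2 h)
    | @tail b z hb hbz ih =>
      intro h1 h2
      have hlt' := hJ₀ b z hbz
      rcases lt_or_ge b y with hby | hby
      · exact hb.tail (hpull₀ b z hby h1 h2 hbz)
      · exact ih hby (by omega)
  exact key e hxe hye le_rfl

/-- In a finite join-semilattice with bottom, the meet is the join of the common lower bounds. -/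
theorem exists_isGLB_pair (s t : EventWord m n) :
    ∃ u : EventWord m n, u ≤ s ∧ u ≤ t ∧ ∀ v, v ≤ s → v ≤ t → v ≤ u := by
  classical
  choose sup h1 h2 h3 using exists_isLUB_pair (m := m) (n := n)
  obtain ⟨b, hb⟩ := exists_bot (m := m) (n := n)
  let _ : SemilatticeSup (EventWord m n) :=
    { sup := sup, le_sup_left := h1, le_sup_right := h2
      sup_le := fun s t u => h3 s t u }
  let _ : OrderBot (EventWord m n) := { bot := b, bot_le := hb }
  have := Fintype.ofFinite (EventWord m n)
  exact ⟨(Finset.univ.filter fun u => u ≤ s ∧ u ≤ t).sup id,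
    Finset.sup_le fun u hu => (Finset.mem_filter.1 hu).2.1,
    Finset.sup_le fun u hu => (Finset.mem_filter.1 hu).2.2,
    fun u hs ht => Finset.le_sup (f := id) (Finset.mem_filter.2 ⟨Finset.mem_univ _, hs, ht⟩)⟩

noncomputable instance : Lattice (EventWord m n) where
  sup s t := (exists_isLUB_pair s t).choose
  le_sup_left s t := (exists_isLUB_pair s t).choose_spec.1
  le_sup_right s t := (exists_isLUB_pair s t).choose_spec.2.1
  sup_le s t u := (exists_isLUB_pair s t).choose_spec.2.2 u
  inf s t := (exists_isGLB_pair s t).choose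
  inf_le_left s t := (exists_isGLB_pair s t).choose_spec.1
  inf_le_right s t := (exists_isGLB_pair s t).choose_spec.2.1
  le_inf u s t := (exists_isGLB_pair s t).choose_spec.2.2 u

end EventWord

/-! ### Words with no cut, and words with a single cut -/

namespace EventWord

variable {n : ℕ}

/-- With no cut, an event word is a set of places where to split `n`. -/
theorem exists_orderIso_set : Nonempty (EventWord 0 n ≃o Set (Fin (n - 1))) := by
  let f : EventWord 0 n → Set (Fin (n - 1)) := fun s => {i | i.1 + 1 ∈ s.letters}
  have hf : ∀ s t, f s ≤ f t ↔ s ≤ t := by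
    refine fun s t => ⟨fun h => ⟨fun x hx => ?_, fun x y hxy => ⟨hxy.1, fun h => by omega⟩⟩,
      fun h i hi => h.1 _ hi⟩
    have hb := s.bounds hx (Nat.zero_le x)
    -- The end `n` belongs to every word with `n > 0`, so only the other `n - 1` places carry
    -- information.
    rcases eq_or_ne x n with rfl | hxn
    · simpa using t.last_mem hb.1
    · have hi : (⟨x - 1, by omega⟩ : Fin (n - 1)) ∈ f s := by
        change x - 1 + 1 ∈ s.letters
        rwa [Nat.sub_add_cancel hb.1]
      have h' : x - 1 + 1 ∈ t.letters := h hi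
      rwa [Nat.sub_add_cancel hb.1] at h'
  refine ⟨RelIso.ofSurjective (OrderEmbedding.ofMapLEIff f hf) fun D => ?_⟩
  classical
  let X : Finset ℕ := (Finset.range (n + 1)).filter fun x =>
    0 < x ∧ (x = n ∨ ∃ i ∈ D, i.1 + 1 = x)
  have hX : ∀ x, x ∈ X ↔ x < n + 1 ∧ 0 < x ∧ (x = n ∨ ∃ i ∈ D, i.1 + 1 = x) := by
    intro x
    simp only [X, Finset.mem_filter, Finset.mem_range]
  obtain ⟨s, hs, -⟩ := exists_of_rel (m := 0) (n := n) X (fun x y => x < y)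
    (fun x hx => by omega) (fun x hx _ => by have := (hX x).1 hx; omega)
    (fun h => (hX _).2 ⟨by omega, by omega, Or.inl (by omega)⟩) (fun _ _ h => h)
    (fun _ _ _ h => h) (fun _ _ _ h h' => h.trans h') (fun _ _ _ h _ _ => Or.inl h)
  refine ⟨s, Set.ext fun i => ?_⟩
  change i.1 + 1 ∈ s.letters ↔ i ∈ D
  rw [hs, hX]
  constructor
  · rintro ⟨-, -, h | ⟨j, hj, h⟩⟩
    · omega
    · rwa [← Fin.ext (Nat.succ_injective h)]
  · exact fun hi => ⟨by omega, by omega, Or.inr ⟨i, hi, rfl⟩⟩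

/-! ### One cut: triwords -/

theorem noninv_mono (s : EventWord 1 n) {y z : ℕ} (hyz : y ≤ z) (hy : 1 ≤ y)
    (h : s.Noninv 0 y) : s.Noninv 0 z := by
  rcases hyz.eq_or_lt with rfl | hlt
  · exact h
  · exact s.noninv_trans h ⟨hlt, fun h' => by omega⟩

open Classical in
/-- The triword of a word with a single cut.  The letters `2` are the units that are not the first
one of a singleton, the letters `0` are the other units below the cut. -/
noncomputable def triword (s : EventWord 1 n) : Triword n :=
  ⟨fun i => if i.1 ≠ 0 ∧ 1 + i.1 ∉ s.letters then 2 else if s.Noninv 0 (i.1 + 2) then 0 else 1, by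
    refine ⟨fun i hi => ?_, fun i j hij h => ?_⟩
    · dsimp only
      rw [if_neg (fun h => h.1 hi)]
      split_ifs <;> decide
    · have hi : ¬ s.Noninv 0 (i.1 + 2) := by
        intro h'
        dsimp only at h
        rw [if_pos h'] at h
        split_ifs at h <;> simp at h
      have hj : ¬ s.Noninv 0 (j.1 + 2) := fun h' => hi (s.noninv_mono (by omega) (by omega) h')
      dsimp only
      rw [if_neg hj]
      split_ifs <;> decide⟩

theorem triword_eq_two (s : EventWord 1 n) (i : Fin n) :
    s.triword.1 i = 2 ↔ i.1 ≠ 0 ∧ 1 + i.1 ∉ s.letters := by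
  unfold triword
  dsimp only
  split_ifs with h1 h2
  · simp only [h1, true_iff]
    exact ⟨h1.1, fun h => h⟩
  · simp [h1]
  · simp [h1]

theorem triword_eq_zero (s : EventWord 1 n) (i : Fin n) :
    s.triword.1 i = 0 ↔ ¬ (i.1 ≠ 0 ∧ 1 + i.1 ∉ s.letters) ∧ s.Noninv 0 (i.1 + 2) := by
  unfold triword
  dsimp only
  split_ifs with h1 h2
  · exact ⟨fun h => by simp at h, fun h => absurd h1 h.1⟩
  · exact ⟨fun _ => ⟨h1, h2⟩, fun _ => rfl⟩
  · exact ⟨fun h => by simp at h, fun h => absurd h.2 h2⟩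

theorem fin_three_le {a b : Fin 3} (h2 : a = 2 → b = 2) (h0 : b = 0 → a = 0) : a ≤ b := by
  revert a b
  decide

/-- Letters `2` mark the missing ends, which gives the inclusion of letters. The noninversions of
the single cut form an up-set among the units, so they are governed by the first unit below the cut,
which starts a singleton and carries a `0`. -/
theorem triword_le_iff (s t : EventWord 1 n) : s.triword ≤ t.triword ↔ t ≤ s := by
  constructor
  · intro h
    have hmem : ∀ x ∈ t.letters, x ∈ s.letters := by
      intro x hx
      rcases Nat.eq_zero_or_pos x with rfl | hx0
      · exact s.label_mem Nat.one_pos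
      obtain ⟨h1, h2⟩ := t.bounds hx hx0
      rcases h2.eq_or_lt with rfl | h2
      · exact s.last_mem (by omega)
      have hi := h ⟨x - 1, by omega⟩
      have ht : t.triword.1 ⟨x - 1, by omega⟩ ≠ 2 := by
        rw [Ne, triword_eq_two, not_and_not_right]
        intro _
        rwa [show 1 + (x - 1) = x by omega]
      have hs : s.triword.1 ⟨x - 1, by omega⟩ ≠ 2 := fun h' => by
        change s.triword.1 _ ≤ t.triword.1 _ at hi
        rw [h'] at hi
        exact ht (le_antisymm (Fin.le_last _) hi)
      rw [Ne, triword_eq_two, not_and_not_right] at hs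
      have := hs (by simp only; omega)
      rwa [show 1 + (x - 1) = x by omega] at this
    refine ⟨hmem, fun x y hxy => ⟨hxy.1, fun hx e he hc => ?_⟩⟩
    obtain rfl : x = 0 := by omega
    have hy := hxy.1
    have hey : y ≤ e := by unfold Covers at hc; omega
    have hb := s.bounds he (by omega)
    classical
    -- The first unit has letter `2`. Since `y` may be `1`, which is the letter of no unit, it is
    -- replaced by `max y 2`.
    have hex : ∃ z, 2 ≤ z ∧ t.Noninv 0 z :=
      ⟨max y 2, le_max_right _ _, t.noninv_mono (le_max_left _ _) hy hxy⟩
    obtain ⟨h2, hN⟩ := Nat.find_spec hex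
    have hle : Nat.find hex ≤ e := (Nat.find_min' hex
      ⟨le_max_right y 2, t.noninv_mono (le_max_left _ _) hy hxy⟩).trans (by omega)
    have hmin := fun z (h : z < Nat.find hex) => Nat.find_min hex h
    set z := Nat.find hex
    have hzi : z - 2 < n := by omega
    have hz : z - 2 + 2 = z := by omega
    have ht : t.triword.1 ⟨z - 2, hzi⟩ = 0 := by
      rw [triword_eq_zero]
      simp only [hz]
      -- If `z - 1` were not an end, the letters covering it would also cover `z`, against the
      -- minimality of `z`.
      refine ⟨fun ⟨h3, h4⟩ => hmin (z - 1) (by omega) ⟨by omega, by omega, fun _ g hg hc' => ?_⟩, hN⟩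
      refine hN.2 Nat.one_pos g hg (Or.inr ⟨by omega, ?_⟩)
      have hne : g ≠ z - 1 := fun h => h4 (by rwa [show 1 + (z - 2) = g by omega])
      unfold Covers at hc'
      omega
    have hs : s.triword.1 ⟨z - 2, hzi⟩ = 0 := by
      have hi := h ⟨z - 2, hzi⟩
      change s.triword.1 _ ≤ t.triword.1 _ at hi
      rw [ht] at hi
      exact le_antisymm hi (Fin.zero_le _)
    have hsN := ((triword_eq_zero _ _).1 hs).2
    simp only [hz] at hsN
    exact hsN.2 Nat.one_pos e he (Or.inr ⟨by omega, hle⟩)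
  · intro h i
    refine fin_three_le ?_ ?_
    · rw [triword_eq_two, triword_eq_two]
      exact fun h' => ⟨h'.1, fun ht => h'.2 (h.1 _ ht)⟩
    · rw [triword_eq_zero, triword_eq_zero]
      exact fun h' => ⟨fun hs => h'.1 ⟨hs.1, fun ht => hs.2 (h.1 _ ht)⟩, h.2 _ _ h'.2⟩

theorem triword_surjective : Function.Surjective (triword (n := n)) := by
  classical
  rintro ⟨w, hw2, hw1⟩
  let X : Finset ℕ := (Finset.range (n + 2)).filter fun x =>
    x = 0 ∨ (1 < x ∧ x = n + 1) ∨ ∃ i : Fin n, i.1 ≠ 0 ∧ w i ≠ 2 ∧ x = 1 + i.1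
  have hX : ∀ x, x ∈ X ↔ x < n + 2 ∧
      (x = 0 ∨ (1 < x ∧ x = n + 1) ∨ ∃ i : Fin n, i.1 ≠ 0 ∧ w i ≠ 2 ∧ x = 1 + i.1) := by
    intro x
    simp only [X, Finset.mem_filter, Finset.mem_range]
  have hXi : ∀ i : Fin n, i.1 ≠ 0 → (1 + i.1 ∈ X ↔ w i ≠ 2) := by
    intro i hi
    rw [hX]
    constructor
    · rintro ⟨-, h | h | ⟨j, -, hj, h⟩⟩
      · omega
      · omega
      · rwa [show i = j from Fin.ext (by omega)]
    · exact fun h => ⟨by omega, Or.inr (Or.inr ⟨i, hi, h, rfl⟩)⟩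
  obtain ⟨s, hs, hN⟩ := exists_of_rel (m := 1) (n := n) X
    -- The cut is placed above an end exactly when a `0` of `w` occurs at a unit up to that end.
    (fun x y => x < y ∧ (x = 0 → ∃ j : Fin n, j.1 + 2 ≤ y ∧ w j = 0))
    (fun x hx => (hX x).2 ⟨by omega, Or.inl (by omega)⟩)
    (fun x hx h => by
      obtain ⟨h1, h2 | h2 | ⟨i, h2, -, h3⟩⟩ := (hX x).1 hx <;> omega)
    (fun h => (hX _).2 ⟨by omega, Or.inr (Or.inl (by omega))⟩) (fun x y h => h.1)
    (fun x y h h' => ⟨h', by omega⟩)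
    (fun x y z h h' => ⟨h.1.trans h'.1, fun h0 => by
      obtain ⟨j, hj, hj'⟩ := h.2 h0
      exact ⟨j, hj.trans h'.1.le, hj'⟩⟩)
    (fun x y z h h' _ => Or.inr ⟨h', by omega⟩)
  have htwo : ∀ i, s.triword.1 i = 2 ↔ w i = 2 := by
    intro i
    rw [triword_eq_two, hs]
    constructor
    · rintro ⟨h, h'⟩
      rwa [hXi i h, not_not] at h'
    · intro h
      have h0 : i.1 ≠ 0 := fun h0 => hw2 i h0 h
      exact ⟨h0, by rwa [hXi i h0, not_not]⟩
  have hzero : ∀ i, s.triword.1 i = 0 ↔ w i = 0 := by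
    intro i
    have h2 := htwo i
    rw [triword_eq_two] at h2
    rw [triword_eq_zero, h2, hN]
    constructor
    · rintro ⟨h, h1, h3⟩
      by_contra h0
      have hi : w i = 1 := (show ∀ a : Fin 3, a ≠ 2 → a ≠ 0 → a = 1 by decide) _ h h0
      -- A `0` at `j` after the `1` at `i` starts a singleton, so the preceding unit is an end; the
      -- cut being above that end forces an earlier `0`. Descent excludes every `0`, whereas the end
      -- `n + 1` requires one.
      have hnz : ∀ k, ∀ j : Fin n, j.1 = k → w j ≠ 0 := by
        intro k
        induction k using Nat.strong_induction_on with
        | _ k ih =>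
          rintro j rfl hj
          rcases lt_trichotomy j i with hji | rfl | hji
          · exact hw1 i j hji hi hj
          · exact h0 hj
          · have hlt : i.1 < j.1 := hji
            have hj2 : w j ≠ 2 := by rw [hj]; decide
            obtain ⟨j', h4, h5⟩ := (h3 Nat.one_pos (1 + j.1) ((hXi j (by omega)).2 hj2)
              (Or.inr ⟨by omega, by omega⟩)).2 rfl
            exact ih j'.1 (by omega) j' rfl h5
      obtain ⟨j, -, hj⟩ := (h3 Nat.one_pos (n + 1)
        ((hX _).2 ⟨by omega, Or.inr (Or.inl ⟨by omega, rfl⟩)⟩)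
        (Or.inr ⟨by omega, by omega⟩)).2 rfl
      exact hnz _ j rfl hj
    · intro h
      refine ⟨by rw [h]; decide, by omega, fun _ e _ hc => ?_⟩
      unfold Covers at hc
      exact ⟨by omega, fun _ => ⟨i, by omega, h⟩⟩
  refine ⟨s, Subtype.ext (funext fun i => ?_)⟩
  exact le_antisymm (fin_three_le (htwo i).1 (hzero i).2) (fin_three_le (htwo i).2 (hzero i).1)

/-- With a single cut, event words form the opposite of the lattice of triwords. -/
theorem exists_orderIso_triword : Nonempty (EventWord 1 n ≃o (Triword n)ᵒᵈ) := by
  let f : EventWord 1 n → (Triword n)ᵒᵈ := fun s => OrderDual.toDual s.triword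
  refine ⟨RelIso.ofSurjective (OrderEmbedding.ofMapLEIff f fun s t => ?_) fun w => ?_⟩
  · exact OrderDual.toDual_le_toDual.trans (triword_le_iff t s)
  · obtain ⟨s, hs⟩ := triword_surjective (OrderDual.ofDual w)
    exact ⟨s, congrArg OrderDual.toDual hs⟩

end EventWord

/-! ### Event words of unary lighted shades -/

namespace LightedShade

variable {m : ℕ}

/-- The event word of a list of unary levels, where `k` is the letter of the last unit above. -/
def encode : ℕ → List (List ℕ × Finset (Fin m)) → List ℕ
  | _, [] => []
  | k, L :: l => (if L.2 = ∅ then k + L.1.sum else ∑ a ∈ L.2, a.1) :: encode (k + L.1.sum) l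

/-- The levels of an event word, where `k` is the letter of the last unit above. -/
def decode (m : ℕ) : ℕ → List ℕ → List (List ℕ × Finset (Fin m))
  | _, [] => []
  | k, x :: l =>
    if h : x < m then ([], {⟨x, h⟩}) :: decode m k l else ([x - k], ∅) :: decode m x l

theorem encode_cut (k : ℕ) (a : Fin m) (l : List (List ℕ × Finset (Fin m))) :
    encode k (([], {a}) :: l) = a.1 :: encode k l := by
  simp [encode]

theorem encode_singleton (k x : ℕ) (l : List (List ℕ × Finset (Fin m))) :
    encode k (([x], ∅) :: l) = (k + x) :: encode (k + x) l := by
  simp [encode]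

theorem decode_cut (k : ℕ) (a : Fin m) (l : List ℕ) :
    decode m k (a.1 :: l) = ([], {a}) :: decode m k l := by
  simp [decode]

theorem decode_singleton (k : ℕ) {x : ℕ} (hx : m ≤ x) (l : List ℕ) :
    decode m k (x :: l) = ([x - k], ∅) :: decode m x l := by
  simp [decode, hx.not_gt]

theorem encode_append (k : ℕ) (l l' : List (List ℕ × Finset (Fin m))) :
    encode k (l ++ l') = encode k l ++ encode (k + (l.map fun L => L.1.sum).sum) l' := by
  induction l generalizing k with
  | nil => simp [encode]
  | cons L l ih => simp [encode, ih, add_assoc]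

/-- Decoding a suffix depends on the prefix only through `q`, the last end in it, or `k` if there is
none. -/
theorem exists_decode_append {N k : ℕ} (hk : m ≤ k) {A B : List ℕ}
    (h : EndsFrom m N k (A ++ B)) : ∃ q, m ≤ q ∧ EndsFrom m N q B ∧
      ∀ C, decode m k (A ++ C) = decode m k A ++ decode m q C := by
  induction A generalizing k with
  | nil => exact ⟨k, hk, h, fun C => rfl⟩
  | cons x A ih =>
    rcases h with ⟨hx, h⟩ | ⟨hx, -, h⟩
    · obtain ⟨q, hq, hB, hd⟩ := ih hk h
      exact ⟨q, hq, hB, fun C => by simp [decode, hx, hd]⟩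
    · obtain ⟨q, hq, hB, hd⟩ := ih hx h
      exact ⟨q, hq, hB, fun C => by simp [decode, hx.not_gt, hd]⟩

variable {l : List (List ℕ × Finset (Fin m))}

theorem endsFrom_encode {k : ℕ} (hk : m ≤ k)
    (hu : ∀ L ∈ l, (∃ a : Fin m, L = ([], {a})) ∨ (∃ x : ℕ, L = ([x], ∅)))
    (hp : ∀ L ∈ l, ∀ x ∈ L.1, 0 < x) :
    EndsFrom m (k + (l.map fun L => L.1.sum).sum) k (encode k l) := by
  induction l generalizing k with
  | nil => exact rfl
  | cons L l ih =>
    obtain ⟨hu1, hu2⟩ := List.forall_mem_cons.1 hu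
    obtain ⟨hp1, hp2⟩ := List.forall_mem_cons.1 hp
    rcases hu1 with ⟨a, rfl⟩ | ⟨x, rfl⟩
    · rw [encode_cut]
      exact Or.inl ⟨a.2, by simpa using ih hk hu2 hp2⟩
    · rw [encode_singleton]
      have hx : 0 < x := hp1 x (by simp)
      exact Or.inr ⟨by omega, by omega,
        by simpa [add_assoc] using ih (k := k + x) (by omega) hu2 hp2⟩

theorem count_encode {k : ℕ} (hk : m ≤ k)
    (hu : ∀ L ∈ l, (∃ a : Fin m, L = ([], {a})) ∨ (∃ x : ℕ, L = ([x], ∅))) (a : Fin m) :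
    (encode k l).count a.1 = l.countP fun L => a ∈ L.2 := by
  induction l generalizing k with
  | nil => rfl
  | cons L l ih =>
    obtain ⟨hu1, hu2⟩ := List.forall_mem_cons.1 hu
    rcases hu1 with ⟨b, rfl⟩ | ⟨x, rfl⟩
    · rw [encode_cut, List.count_cons, List.countP_cons, ih hk hu2]
      rcases eq_or_ne a b with rfl | hab
      · simp
      · simp [hab, Fin.val_inj, hab.symm]
    · rw [encode_singleton, List.count_cons_of_ne (by omega), ih (by omega) hu2]
      simp

theorem decode_encode {k : ℕ} (hk : m ≤ k)
    (hu : ∀ L ∈ l, (∃ a : Fin m, L = ([], {a})) ∨ (∃ x : ℕ, L = ([x], ∅))) :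
    decode m k (encode k l) = l := by
  induction l generalizing k with
  | nil => rfl
  | cons L l ih =>
    obtain ⟨hu1, hu2⟩ := List.forall_mem_cons.1 hu
    rcases hu1 with ⟨a, rfl⟩ | ⟨x, rfl⟩
    · rw [encode_cut, decode_cut, ih hk hu2]
    · rw [encode_singleton, decode_singleton k (by omega), ih (by omega) hu2,
        Nat.add_sub_cancel_left]

theorem encode_decode {N k : ℕ} {w : List ℕ} (h : EndsFrom m N k w) :
    encode k (decode m k w) = w := by
  induction w generalizing k with
  | nil => rfl
  | cons x w ih =>
    rcases h with ⟨hx, h⟩ | ⟨hx, hk, h⟩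
    · rw [decode_cut k ⟨x, hx⟩, encode_cut, ih h]
    · rw [decode_singleton k hx, encode_singleton, Nat.add_sub_cancel' hk.le, ih h]

theorem decode_unary (k : ℕ) (w : List ℕ) :
    ∀ L ∈ decode m k w, (∃ a : Fin m, L = ([], {a})) ∨ (∃ x : ℕ, L = ([x], ∅)) := by
  induction w generalizing k with
  | nil => simp [decode]
  | cons x w ih =>
    unfold decode
    split_ifs with h
    · exact List.forall_mem_cons.2 ⟨Or.inl ⟨_, rfl⟩, ih k⟩
    · exact List.forall_mem_cons.2 ⟨Or.inr ⟨_, rfl⟩, ih x⟩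

theorem decode_pos {N k : ℕ} {w : List ℕ} (h : EndsFrom m N k w) :
    ∀ L ∈ decode m k w, ∀ x ∈ L.1, 0 < x := by
  induction w generalizing k with
  | nil => simp [decode]
  | cons x w ih =>
    rcases h with ⟨hx, h⟩ | ⟨hx, hk, h⟩
    · rw [decode_cut k ⟨x, hx⟩]
      exact List.forall_mem_cons.2 ⟨by simp, ih h⟩
    · rw [decode_singleton k hx]
      exact List.forall_mem_cons.2 ⟨by simpa using hk, ih h⟩

theorem decode_sum {N k : ℕ} {w : List ℕ} (h : EndsFrom m N k w) :
    k + ((decode m k w).map fun L => L.1.sum).sum = N := by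
  induction w generalizing k with
  | nil => simpa [decode] using (show k = N from h)
  | cons x w ih =>
    rcases h with ⟨hx, h⟩ | ⟨hx, hk, h⟩
    · rw [decode_cut k ⟨x, hx⟩]
      simpa using ih h
    · rw [decode_singleton k hx, ← ih h]
      simp only [List.map_cons, List.sum_cons, List.sum_nil]
      omega

theorem wordStep_encode {l l' : List (List ℕ × Finset (Fin m))} (h : RotationStep l l') :
    WordStep m (encode m l) (encode m l') := by
  cases h with
  | split A B s t hs ht =>
    simp only [encode_append, encode_singleton, ← add_assoc]
    exact WordStep.insert _ _ _ _ (by omega) (by omega)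
  | sweep A B s a =>
    simp only [encode_append, encode_singleton, encode_cut]
    exact WordStep.swap _ _ _ _ a.2 (by omega)
  | swap A B a b hab =>
    simp only [encode_append, encode_cut]
    exact WordStep.swap _ _ _ _ a.2 hab

theorem rotationStep_decode {N : ℕ} {w w' : List ℕ} (hw : EndsFrom m N m w')
    (h : WordStep m w w') : RotationStep (decode m m w) (decode m m w') := by
  cases h with
  | insert A B e f he hef =>
    -- The prefix `A` is common to both words, so the same `q` serves for both decodings.
    obtain ⟨q, hq, hB, hd⟩ := exists_decode_append le_rfl hw
    obtain ⟨h, -⟩ | ⟨-, hqe, -⟩ := hB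
    · omega
    · rw [hd, hd, decode_singleton q (by omega), decode_singleton q he.le,
        decode_singleton e (by omega), show f - q = (e - q) + (f - e) by omega]
      exact RotationStep.split _ _ _ _ (by omega) (by omega)
  | swap A B x y hx hxy =>
    obtain ⟨q, hq, hB, hd⟩ := exists_decode_append le_rfl hw
    rw [hd, hd]
    rcases lt_or_ge y m with hy | hy
    · rw [decode_cut q ⟨y, hy⟩, decode_cut q ⟨x, hx⟩, decode_cut q ⟨x, hx⟩, decode_cut q ⟨y, hy⟩]
      exact RotationStep.swap _ _ _ _ hxy
    · rw [decode_singleton q hy, decode_cut y ⟨x, hx⟩, decode_cut q ⟨x, hx⟩, decode_singleton q hy]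
      exact RotationStep.sweep _ _ _ _

end LightedShade

/-! ### Transport from event words to shades -/

open LightedShade

/-- Unary lighted shades correspond to event words. -/
def UnaryLightedShade.equivEventWord (m n : ℕ) : UnaryLightedShade m n ≃ EventWord m n where
  toFun s := ⟨encode m s.1.levels, by
    simpa only [s.1.sum_eq] using endsFrom_encode le_rfl s.2 s.1.entries_pos,
    fun x hx => (count_encode le_rfl s.2 ⟨x, hx⟩).trans (s.1.label_once ⟨x, hx⟩)⟩
  invFun w := ⟨⟨decode m m w.letters, decode_pos w.ends, Nat.add_left_cancel (decode_sum w.ends),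
    fun a => by
      rw [← count_encode le_rfl (decode_unary m _), encode_decode w.ends, w.count_label _ a.2],
    fun L hL h => by
      rcases decode_unary m _ L hL with ⟨a, rfl⟩ | ⟨x, rfl⟩
      · exact Finset.singleton_nonempty a
      · simp at h⟩, decode_unary m _⟩
  left_inv s := by
    obtain ⟨⟨l, h1, h2, h3, h4⟩, hu⟩ := s
    refine Subtype.ext ?_
    rw [LightedShade.mk.injEq]
    exact decode_encode le_rfl hu
  right_inv w := EventWord.ext (encode_decode w.ends)

theorem UnaryLightedShade.rightRotation_iff {m n : ℕ} (s t : UnaryLightedShade m n) :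
    RightRotation s t ↔
      WordStep m (equivEventWord m n s).letters (equivEventWord m n t).letters := by
  refine ⟨wordStep_encode, fun h => ?_⟩
  have h' := rotationStep_decode (equivEventWord m n t).ends h
  change RotationStep (decode m m (encode m s.1.levels)) (decode m m (encode m t.1.levels)) at h'
  rwa [decode_encode le_rfl s.2, decode_encode le_rfl t.2] at h'

theorem mainTheorem5 (m n : ℕ) :
    ∃ _ : Lattice (UnaryLightedShade m n),
      (∀ s t : UnaryLightedShade m n, s ≤ t ↔ Relation.ReflTransGen RightRotation s t) ∧
      (∀ s t : UnaryLightedShade m n, s ⋖ t ↔ RightRotation s t) ∧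
      (m = 1 → Nonempty (UnaryLightedShade m n ≃o (Triword n)ᵒᵈ)) ∧
      (m = 0 → Nonempty (UnaryLightedShade m n ≃o Set (Fin (n - 1)))) := by
  let e := UnaryLightedShade.equivEventWord m n
  let _ : PartialOrder (UnaryLightedShade m n) := PartialOrder.lift e e.injective
  let f : UnaryLightedShade m n ≃o EventWord m n := ⟨e, Iff.rfl⟩
  let L : Lattice (UnaryLightedShade m n) :=
    { sup := fun s t => f.symm (f s ⊔ f t)
      le_sup_left := fun s t => (f.le_symm_apply).2 le_sup_left
      le_sup_right := fun s t => (f.le_symm_apply).2 le_sup_right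
      sup_le := fun s t u hs ht => (f.symm_apply_le).2 (sup_le (f.monotone hs) (f.monotone ht))
      inf := fun s t => f.symm (f s ⊓ f t)
      inf_le_left := fun s t => (f.symm_apply_le).2 inf_le_left
      inf_le_right := fun s t => (f.symm_apply_le).2 inf_le_right
      le_inf := fun s t u hs ht => (f.le_symm_apply).2 (le_inf (f.monotone hs) (f.monotone ht)) }
  refine ⟨L, fun s t => ?_, fun s t => ?_, ?_, ?_⟩
  · rw [show s ≤ t ↔ f s ≤ f t from Iff.rfl, ← EventWord.reflTransGen_iff_le]
    constructor
    · intro h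
      have h' : Relation.ReflTransGen RightRotation (f.symm (f s)) (f.symm (f t)) := by
        refine h.lift f.symm fun u v huv => (UnaryLightedShade.rightRotation_iff _ _).2 ?_
        change WordStep m (f (f.symm u)).letters (f (f.symm v)).letters
        rwa [f.apply_symm_apply, f.apply_symm_apply]
      rwa [f.symm_apply_apply, f.symm_apply_apply] at h'
    · exact fun h => h.lift f fun u v huv => (UnaryLightedShade.rightRotation_iff u v).1 huv
  · rw [UnaryLightedShade.rightRotation_iff, ← EventWord.covBy_iff_wordStep]
    exact (apply_covBy_apply_iff f).symm
  · rintro rfl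
    exact EventWord.exists_orderIso_triword.map f.trans
  · rintro rfl
    exact EventWord.exists_orderIso_set.map f.trans
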